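/- Let $\mathcal{A}$ be a complex Banach algebra with identity $1$. For $S\subseteq\mathcal{A}$ let $S'=\{b\in\mathcal{A}: bs=sb \text{ for all } s\in S\}$, and $\{a\}''=(\{a\}')'$. Let $\mathcal{A}^{qnil}=\{a\in\mathcal{A}:\sigma(a)=\{0\}\}$. An element $a\in\mathcal{A}$ is generalized Drazin invertible if there is $x\in\{a\}'$ with $xax=x$ and $a-a^{2}x\in\mathcal{A}^{qnil}$. Let $\mathcal{A}^{acc}$ be the set of all $a\in\mathcal{A}$ such that $a-\lambda 1$ is generalized Drazin invertible for every $\lambda\in\mathbb{C}\setminus\{0\}$. An ag-Drazin inverse of $a$ is an element $x\in\{a\}'$ with $xax=x$ and $a-a^{2}x\in\mathcal{A}^{acc}$; $a$ is ag-Drazin invertible if it has an ag-Drazin inverse. Theorem. Let $a\in\mathcal{A}$. The following statements are equivalent. (1) $a$ is ag-Drazin invertible. (2) There exists an idempotent $p\in\{a\}''$ such that $a+p$ is invertible in $\mathcal{A}$ and $ap\in\mathcal{A}^{acc}$. (3) There exists an idempotent $p\in\{a\}'$ such that $a+p$ is invertible in $\mathcal{A}$ and $ap\in\mathcal{A}^{acc}$.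 Moreover, for every idempotent $p$ as in (2) or (3), the element $(a+p)^{-1}(1-p)$ is an ag-Drazin inverse of $a$. -/

import Mathlib

namespace AGDrazin

/-- The quasinilpotent elements: those whose spectrum is exactly `{0}`. -/
def qnil (A : Type*) [Ring A] [Algebra ℂ A] : Set A :=
  {a | spectrum ℂ a = {0}}

/-- `x` is a generalized Drazin inverse of `a`: `x` commutes with `a`, `x a x = x` and
`a - a² x` is quasinilpotent. -/
def IsGDrazinInverse {A : Type*} [Ring A] [Algebra ℂ A] (a x : A) : Prop :=
  x ∈ Set.centralizer {a} ∧ x * a * x = x ∧ a - a ^ 2 * x ∈ qnil A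

/-- The generalized Drazin invertible elements. -/
def gDrazin (A : Type*) [Ring A] [Algebra ℂ A] : Set A :=
  {a | ∃ x : A, IsGDrazinInverse a x}

/-- The elements `a` such that `a - λ 1` is generalized Drazin invertible for every `λ ≠ 0`. -/
def acc (A : Type*) [Ring A] [Algebra ℂ A] : Set A :=
  {a | ∀ z : ℂ, z ≠ 0 → a - algebraMap ℂ A z ∈ gDrazin A}

/-- `x` is an ag-Drazin inverse of `a`: `x` commutes with `a`, `x a x = x` and
`a - a² x` belongs to `acc A`. -/
def IsAGDrazinInverse {A : Type*} [Ring A] [Algebra ℂ A] (a x : A) : Prop :=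
  x ∈ Set.centralizer {a} ∧ x * a * x = x ∧ a - a ^ 2 * x ∈ acc A

/-- The ag-Drazin invertible elements. -/
def agDrazin (A : Type*) [Ring A] [Algebra ℂ A] : Set A :=
  {a | ∃ x : A, IsAGDrazinInverse a x}

end AGDrazin

/-!
The implication (3) ⇒ (1) is ring theory. For (1) ⇒ (2), let `x` be an ag-Drazin inverse of `a`. The
spectrum of `b = a - a² x` accumulates at most at `0`, and where `a x` is `1` the values of `a` are
bounded below. So for a small disc `U` around `0`, `a` has a spectral idempotent `p` for `U`, namely
`(1 - a x) ∏ (b - z) w_z`, with `z` ranging over the finitely many spectral points of `b` outside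
`U` and `w_z` a g-Drazin inverse of `b - z`. Its properties are read off from Gelfand theory in the
double commutant of `{a, x}`, a commutative Banach algebra with the same spectra.

To see that `p` lies in the double commutant of `{a}`, put `y = (a + p)⁻¹ (1 - p)` and `e = a y`.
If `c` commutes with `a`, the corner `v = (1 - e) c e` satisfies `v = (a - a² y)ⁿ v yⁿ` for every
`n`. Here `a - a² y = a p` has spectral radius less than the radius of `U` and `y` at most its
inverse, so `v = 0`; the opposite corner vanishes likewise and `c` commutes with `e = 1 - p`.
-/

namespace AGDrazin

open Filter Metric Topology WeakDual

open scoped NNReal ENNReal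

section Ring

variable {A : Type*} [Ring A]

theorem isIdempotentElem_mul_of_mul_mul_eq {a x : A} (hxax : x * a * x = x) :
    IsIdempotentElem (a * x) := by
  rw [IsIdempotentElem, mul_assoc, ← mul_assoc x, hxax]

theorem commute_of_mul_mul_one_sub_eq_zero {c e : A} (h₁ : e * c * (1 - e) = 0)
    (h₂ : (1 - e) * c * e = 0) : Commute e c := by
  have hec : e * c = e * c * e := by rwa [mul_sub, mul_one, sub_eq_zero] at h₁
  have hce : c * e = e * c * e := by rwa [sub_mul, one_mul, sub_mul, sub_eq_zero] at h₂
  exact hec.trans hce.symm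

theorem commute_of_commute_mul_of_mul_mul_eq {a c x : A} (hac : Commute a c) (hax : Commute a x)
    (hxax : x * a * x = x) (hc : Commute (a * x) c) : Commute x c := by
  have hxc : x * c = x * (a * c) * x :=
    calc x * c = x * (a * x * c) := by rw [← mul_assoc, ← mul_assoc, hxax]
      _ = x * (c * a * x) := by rw [hc.eq, mul_assoc c]
      _ = x * (a * c) * x := by rw [← hac.eq, mul_assoc x]
  have hcx : c * x = x * (a * c) * x :=
    calc c * x = c * (a * x) * x := by rw [hax.eq, mul_assoc, hxax]
      _ = x * (a * c) * x := by rw [← hc.eq, hax.eq, mul_assoc x]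
  exact hxc.trans hcx.symm

variable {a p : A}

theorem commute_inverse_add_mul_one_sub (hap : Commute a p) (hu : IsUnit (a + p)) :
    Commute a (Ring.inverse (a + p) * (1 - p)) := by
  obtain ⟨u, hu⟩ := hu
  rw [← hu, Ring.inverse_unit]
  have hau : Commute a u := hu ▸ (Commute.refl a).add_right hap
  exact hau.units_inv_right.mul_right ((Commute.one_right a).sub_right hap)

theorem inverse_add_mul_one_sub_mul (hp : IsIdempotentElem p) (hap : Commute a p)
    (hu : IsUnit (a + p)) : Ring.inverse (a + p) * (1 - p) * a = 1 - p := by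
  have h : (1 - p) * a = (a + p) * (1 - p) := by
    rw [sub_mul, one_mul, ← hap.eq, add_mul, hp.mul_one_sub_self, add_zero, mul_sub, mul_one]
  rw [mul_assoc, h, Ring.inverse_mul_cancel_left _ _ hu]

theorem mul_inverse_add_mul_one_sub (hap : Commute a p) (hu : IsUnit (a + p)) :
    p * (Ring.inverse (a + p) * (1 - p)) = Ring.inverse (a + p) * (1 - p) * p := by
  obtain ⟨u, hu⟩ := hu
  rw [← hu, Ring.inverse_unit]
  have hpu : Commute p u := hu ▸ hap.symm.add_right (Commute.refl p)
  exact (hpu.units_inv_right.mul_right ((Commute.one_right p).sub_right (Commute.refl p))).eq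

theorem inverse_add_mul_one_sub_mul_mul (hp : IsIdempotentElem p) (hap : Commute a p)
    (hu : IsUnit (a + p)) :
    Ring.inverse (a + p) * (1 - p) * a * (Ring.inverse (a + p) * (1 - p)) =
      Ring.inverse (a + p) * (1 - p) := by
  rw [inverse_add_mul_one_sub_mul hp hap hu, sub_mul, one_mul, mul_inverse_add_mul_one_sub hap hu,
    mul_assoc, hp.one_sub_mul_self, mul_zero, sub_zero]

theorem sub_sq_mul_inverse_add_mul_one_sub (hp : IsIdempotentElem p) (hap : Commute a p)
    (hu : IsUnit (a + p)) : a - a ^ 2 * (Ring.inverse (a + p) * (1 - p)) = a * p := by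
  rw [sq, mul_assoc, (commute_inverse_add_mul_one_sub hap hu).eq,
    inverse_add_mul_one_sub_mul hp hap hu, mul_sub, mul_one, sub_sub_cancel]

end Ring

theorem isAGDrazinInverse_inverse_add_mul_one_sub {A : Type*} [Ring A] [Algebra ℂ A] {a p : A}
    (hp : IsIdempotentElem p) (hap : Commute a p) (hu : IsUnit (a + p)) (hacc : a * p ∈ acc A) :
    IsAGDrazinInverse a (Ring.inverse (a + p) * (1 - p)) := by
  refine ⟨?_, inverse_add_mul_one_sub_mul_mul hp hap hu, ?_⟩
  · rintro _ rfl
    exact (commute_inverse_add_mul_one_sub hap hu).eq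
  · rwa [sub_sq_mul_inverse_add_mul_one_sub hp hap hu]

section BanachAlgebra

variable {A : Type*} [NormedRing A] [NormedAlgebra ℂ A] [CompleteSpace A]

theorem spectralRadius_ne_top (a : A) : spectralRadius ℂ a ≠ ∞ :=
  ((spectrum.spectralRadius_le_pow_nnnorm_pow_one_div ℂ a 0).trans_lt (by finiteness)).ne

theorem tendsto_norm_pow_mul_norm_pow_of_spectralRadius_mul_lt_one {u y : A}
    (h : spectralRadius ℂ u * spectralRadius ℂ y < 1) :
    Tendsto (fun n : ℕ => ‖u ^ n‖ * ‖y ^ n‖) atTop (𝓝 0) := by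
  obtain ⟨s, hs, hs1⟩ := ENNReal.lt_iff_exists_nnreal_btwn.1 h
  have hlim := ENNReal.Tendsto.mul
    (spectrum.pow_nnnorm_pow_one_div_tendsto_nhds_spectralRadius u)
    (.inr (spectralRadius_ne_top y))
    (spectrum.pow_nnnorm_pow_one_div_tendsto_nhds_spectralRadius y)
    (.inr (spectralRadius_ne_top u))
  refine squeeze_zero' (.of_forall fun n => by positivity) ?_
    (tendsto_pow_atTop_nhds_zero_of_lt_one s.coe_nonneg (by exact_mod_cast hs1))
  filter_upwards [hlim.eventually_lt_const hs, eventually_ne_atTop 0] with n hn hn0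
  rw [← ENNReal.mul_rpow_of_nonneg _ _ (by positivity), one_div] at hn
  have hpow := (ENNReal.rpow_inv_le_iff (by positivity)).1 hn.le
  rw [ENNReal.rpow_natCast] at hpow
  exact_mod_cast hpow

theorem eq_zero_of_mul_mul_eq_self {u v y : A} (hv : u * v * y = v)
    (h : spectralRadius ℂ u * spectralRadius ℂ y < 1) : v = 0 := by
  have hiter (n : ℕ) : u ^ n * v * y ^ n = v := by
    induction n with
    | zero => simp
    | succ n ih =>
      calc u ^ (n + 1) * v * y ^ (n + 1) = u ^ n * (u * v * y) * y ^ n := by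
            rw [pow_succ, pow_succ']; simp only [mul_assoc]
        _ = v := by rw [hv, ih]
  have hbound (n : ℕ) : ‖v‖ ≤ ‖u ^ n‖ * ‖y ^ n‖ * ‖v‖ :=
    calc ‖v‖ = ‖u ^ n * v * y ^ n‖ := by rw [hiter]
      _ ≤ ‖u ^ n‖ * ‖v‖ * ‖y ^ n‖ := norm_mul₃_le
      _ = ‖u ^ n‖ * ‖y ^ n‖ * ‖v‖ := mul_right_comm _ _ _
  have hlim :=
    (tendsto_norm_pow_mul_norm_pow_of_spectralRadius_mul_lt_one h).mul_const ‖v‖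
  rw [zero_mul] at hlim
  exact norm_le_zero_iff.1 (ge_of_tendsto' hlim hbound)

theorem mem_centralizer_centralizer_of_spectralRadius_mul_lt_one {a x : A} (hax : Commute a x)
    (hxax : x * a * x = x)
    (h : spectralRadius ℂ (a - a ^ 2 * x) * spectralRadius ℂ x < 1) :
    x ∈ Set.centralizer (Set.centralizer {a}) := by
  intro c hc
  have hac : Commute a c := hc a rfl
  have he := isIdempotentElem_mul_of_mul_mul_eq hxax
  set e := a * x with he_def
  have hea : Commute e a := (Commute.refl a).mul_left hax.symm
  have hex : e * x = x := by rw [he_def, hax.eq, hxax]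
  have hxe : x * e = x := by rw [he_def, ← mul_assoc, hxax]
  have hb : a - a ^ 2 * x = a * (1 - e) := by rw [mul_sub, mul_one, sq, mul_assoc]
  have hb' : a - a ^ 2 * x = (1 - e) * a := by rw [hb, mul_sub, sub_mul, hea.eq, mul_one, one_mul]
  have hlower : (1 - e) * c * e = 0 := by
    refine eq_zero_of_mul_mul_eq_self ?_ h
    calc (a - a ^ 2 * x) * ((1 - e) * c * e) * x
        = a * ((1 - e) * (1 - e)) * c * (e * x) := by rw [hb]; simp only [mul_assoc]
      _ = (1 - e) * (a * c) * x := by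
          rw [he.one_sub.eq, hex, ← hb, hb', mul_assoc (1 - e)]
      _ = (1 - e) * c * e := by rw [hac.eq, he_def]; simp only [mul_assoc]
  have hupper : e * c * (1 - e) = 0 := by
    refine eq_zero_of_mul_mul_eq_self ?_ (mul_comm (spectralRadius ℂ x) _ ▸ h)
    calc x * (e * c * (1 - e)) * (a - a ^ 2 * x)
        = x * e * c * ((1 - e) * (1 - e)) * a := by rw [hb']; simp only [mul_assoc]
      _ = x * (c * a) * (1 - e) := by
          rw [hxe, he.one_sub.eq, mul_assoc _ (1 - e), ← hb', hb]; simp only [mul_assoc]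
      _ = e * c * (1 - e) := by rw [← hac.eq, he_def, hax.eq]; simp only [mul_assoc]
  exact (commute_of_commute_mul_of_mul_mul_eq hac hax hxax
    (commute_of_mul_mul_one_sub_eq_zero hupper hlower)).eq.symm

theorem IsGDrazinInverse.mem_centralizer_centralizer {a x : A} (h : IsGDrazinInverse a x) :
    x ∈ Set.centralizer (Set.centralizer {a}) := by
  obtain ⟨hx, hxax, hq⟩ := h
  refine mem_centralizer_centralizer_of_spectralRadius_mul_lt_one (hx a rfl) hxax ?_
  have hρ : spectralRadius ℂ (a - a ^ 2 * x) = 0 := by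
    simp [spectralRadius, show spectrum ℂ (a - a ^ 2 * x) = {0} from hq]
  simp [hρ]

end BanachAlgebra

section Bicommutant

variable {A : Type*}

/-- The double commutant of a set, as a subalgebra. It is closed under inversion and, when the
elements of the set commute, commutative; hence it reduces spectral questions about these elements
to a commutative Banach algebra. -/
abbrev bicommutant [Ring A] [Algebra ℂ A] (S : Set A) : Subalgebra ℂ A :=
  Subalgebra.centralizer ℂ S.centralizer

section Algebra

variable [Ring A] [Algebra ℂ A] {S : Set A}

theorem isUnit_coe_bicommutant_iff {b : bicommutant S} : IsUnit (b : A) ↔ IsUnit b := by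
  refine ⟨fun ⟨u, hu⟩ => ?_, fun h => h.map (bicommutant S).val⟩
  have hmem : (↑u⁻¹ : A) ∈ bicommutant S := fun c hc =>
    (show Commute c u from hu ▸ b.2 c hc).units_inv_right.eq
  exact ⟨⟨b, ⟨_, hmem⟩, Subtype.ext (by simp [← hu]), Subtype.ext (by simp [← hu])⟩, rfl⟩

theorem spectrum_coe_bicommutant (b : bicommutant S) : spectrum ℂ (b : A) = spectrum ℂ b := by
  ext z
  rw [spectrum.mem_iff, spectrum.mem_iff, ← isUnit_coe_bicommutant_iff]
  rfl

theorem spectralRadius_coe_bicommutant (b : bicommutant S) :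
    spectralRadius ℂ (b : A) = spectralRadius ℂ b := by
  rw [spectralRadius, spectralRadius, spectrum_coe_bicommutant]

theorem coe_bicommutant_mem_centralizer_singleton_iff {b w : bicommutant S} :
    (w : A) ∈ Set.centralizer {(b : A)} ↔ w ∈ Set.centralizer {b} := by
  simp only [Set.mem_centralizer_iff, Set.mem_singleton_iff, forall_eq]
  exact (Subtype.ext_iff (a1 := b * w) (a2 := w * b)).symm

theorem isGDrazinInverse_coe_bicommutant_iff {b w : bicommutant S} :
    IsGDrazinInverse (b : A) (w : A) ↔ IsGDrazinInverse b w := by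
  refine and_congr coe_bicommutant_mem_centralizer_singleton_iff (and_congr ?_ ?_)
  · exact (Subtype.ext_iff (a1 := w * b * w) (a2 := w)).symm
  · exact Eq.congr_left (spectrum_coe_bicommutant (b - b ^ 2 * w))

end Algebra

variable [NormedRing A] [NormedAlgebra ℂ A] {S : Set A}

/-- The double commutant of a set of commuting elements is a commutative normed ring. -/
@[reducible]
def bicommutantNormedCommRing (hS : ∀ s ∈ S, ∀ t ∈ S, s * t = t * s) :
    NormedCommRing (bicommutant S) :=
  { (inferInstance : NormedRing (bicommutant S)) with
    mul_comm := fun b c =>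
      Subtype.ext (Set.centralizer_centralizer_comm_of_comm hS b b.2 c c.2) }

instance [CompleteSpace A] : CompleteSpace (bicommutant S) :=
  (Set.isClosed_centralizer S.centralizer).completeSpace_coe

variable [CompleteSpace A]

theorem coe_bicommutant_mem_acc_iff {b : bicommutant S} :
    (b : A) ∈ acc A ↔ b ∈ acc (bicommutant S) := by
  refine forall₂_congr fun z _ => ⟨fun ⟨w, hw⟩ => ?_, fun ⟨w, hw⟩ => ?_⟩
  · have hle : S.centralizer ⊆ Set.centralizer {(b : A) - algebraMap ℂ A z} := by
      rintro c hc _ rfl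
      exact ((b - algebraMap ℂ (bicommutant S) z).2 c hc).symm
    exact ⟨⟨w, Set.centralizer_subset hle hw.mem_centralizer_centralizer⟩,
      isGDrazinInverse_coe_bicommutant_iff.1 hw⟩
  · exact ⟨w, isGDrazinInverse_coe_bicommutant_iff.2 hw⟩

theorem isAGDrazinInverse_coe_bicommutant_iff {b w : bicommutant S} :
    IsAGDrazinInverse (b : A) (w : A) ↔ IsAGDrazinInverse b w :=
  and_congr coe_bicommutant_mem_centralizer_singleton_iff
    (and_congr (Subtype.ext_iff (a1 := w * b * w) (a2 := w)).symm
      (coe_bicommutant_mem_acc_iff (b := b - b ^ 2 * w)))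

end Bicommutant

section Characters

variable {A F : Type*} [FunLike F A ℂ]

theorem apply_mul_apply_eq_zero_or_one [Ring A] [Algebra ℂ A] [AlgHomClass F ℂ A ℂ] {a x : A}
    (hxax : x * a * x = x) (φ : F) : φ a * φ x = 0 ∨ φ a * φ x = 1 := by
  rw [← map_mul]
  exact IsIdempotentElem.iff_eq_zero_or_one.1 ((isIdempotentElem_mul_of_mul_mul_eq hxax).map φ)

theorem apply_eq_zero_of_mem_qnil [Ring A] [Algebra ℂ A] [AlgHomClass F ℂ A ℂ] {c : A}
    (hc : c ∈ qnil A) (φ : F) : φ c = 0 := by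
  have hmem : φ c ∈ spectrum ℂ c := AlgHom.apply_mem_spectrum φ c
  rwa [show spectrum ℂ c = {0} from hc] at hmem

theorem IsGDrazinInverse.apply_eq_zero_or_apply_mul_apply_eq_one [Ring A] [Algebra ℂ A]
    [AlgHomClass F ℂ A ℂ] {d w : A} (h : IsGDrazinInverse d w) (φ : F) :
    φ d = 0 ∨ φ d * φ w = 1 := by
  have hφ := apply_eq_zero_of_mem_qnil h.2.2 φ
  simp only [map_sub, map_mul, map_pow] at hφ
  have hfactor : φ d * (1 - φ d * φ w) = 0 := by linear_combination hφ
  exact (mul_eq_zero.1 hfactor).imp_right fun h1 => (sub_eq_zero.1 h1).symm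

theorem inv_le_norm_apply_of_apply_mul_apply_eq_one [NormedRing A] [NormedAlgebra ℂ A]
    [CompleteSpace A] [AlgHomClass F ℂ A ℂ] {a x : A} {φ : F} (h : φ a * φ x = 1) :
    (‖x‖ * ‖(1 : A)‖ + 1)⁻¹ ≤ ‖φ a‖ := by
  rw [inv_le_iff_one_le_mul₀ (by positivity)]
  calc (1 : ℝ) = ‖φ a‖ * ‖φ x‖ := by rw [← norm_mul, h, norm_one]
    _ ≤ ‖φ a‖ * (‖x‖ * ‖(1 : A)‖ + 1) := by
      gcongr
      exact (AlgHom.norm_apply_le_self_mul_norm_one φ x).trans (le_add_of_nonneg_right zero_le_one)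

end Characters

section Commutative

variable {B : Type*} [NormedCommRing B] [NormedAlgebra ℂ B]

/-- `q` is the spectral idempotent of `b` for the part of the spectrum of `b` in `U`: its Gelfand
transform is the indicator function of the characters `φ` with `φ b ∈ U`. -/
def IsSpectralIdempotent (b : B) (U : Set ℂ) (q : B) : Prop :=
  IsIdempotentElem q ∧ ∀ φ : characterSpace ℂ B, φ q = 1 ↔ φ b ∈ U

theorem IsSpectralIdempotent.apply_eq_zero_or_one {b q : B} {U : Set ℂ}
    (hq : IsSpectralIdempotent b U q) (φ : characterSpace ℂ B) : φ q = 0 ∨ φ q = 1 :=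
  IsIdempotentElem.iff_eq_zero_or_one.1 (hq.1.map φ)

variable [CompleteSpace B]

theorem mul_mem_qnil {c : B} (hc : c ∈ qnil B) (y : B) : y * c ∈ qnil B := by
  refine Set.Subset.antisymm (fun z hz => ?_) ?_
  · obtain ⟨φ, rfl⟩ := CharacterSpace.mem_spectrum_iff_exists.1 hz
    simp [apply_eq_zero_of_mem_qnil hc φ]
  · rintro _ rfl
    have h0 : (0 : ℂ) ∈ spectrum ℂ c := hc.symm ▸ Set.mem_singleton 0
    obtain ⟨φ, hφ⟩ := CharacterSpace.mem_spectrum_iff_exists.1 h0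
    exact CharacterSpace.mem_spectrum_iff_exists.2 ⟨φ, by simp [hφ]⟩

theorem mul_mem_acc_of_isIdempotentElem {b p : B} (hb : b ∈ acc B) (hp : IsIdempotentElem p) :
    b * p ∈ acc B := by
  intro z hz
  obtain ⟨w, -, hw, hq⟩ := hb z hz
  -- The g-Drazin inverse of `b * p - z` is `w` on the range of `p` and `-z⁻¹` on its complement,
  -- where `b * p - z` is `-z`.
  set ζ := algebraMap ℂ B z
  set ζ' := algebraMap ℂ B z⁻¹
  have hζ : ζ * ζ' = 1 := by rw [← map_mul, mul_inv_cancel₀ hz, map_one]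
  have hpp : p * p = p := hp
  have hmul : (b * p - ζ) * (w * p - ζ' * (1 - p)) = (b - ζ) * w * p + (1 - p) := by
    linear_combination (b * w + b * ζ') * hpp + (1 - p) * hζ
  refine ⟨w * p - ζ' * (1 - p), fun _ _ => mul_comm _ _, ?_, ?_⟩
  · linear_combination (w * p - ζ' * (1 - p)) * hmul + p ^ 2 * hw +
      (ζ' * (b - ζ) * w - ζ') * hpp
  · have hresidue : b * p - ζ - (b * p - ζ) ^ 2 * (w * p - ζ' * (1 - p)) =
        p * (b - ζ - (b - ζ) ^ 2 * w) := by
      linear_combination -(b * p - ζ) * hmul + b * (1 - (b - ζ) * w) * hpp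
    rw [hresidue]
    exact mul_mem_qnil hq p

theorem not_accPt_spectrum_of_mem_acc {b : B} (hb : b ∈ acc B) {z : ℂ} (hz : z ≠ 0) :
    ¬ AccPt z (𝓟 (spectrum ℂ b)) := by
  obtain ⟨w, hw⟩ := hb z hz
  rw [accPt_iff_nhds]
  push Not
  refine ⟨ball z (‖w‖ * ‖(1 : B)‖ + 1)⁻¹, ball_mem_nhds _ (by positivity), ?_⟩
  rintro _ ⟨hball, hspec⟩
  obtain ⟨φ, rfl⟩ := CharacterSpace.mem_spectrum_iff_exists.1 hspec
  have hsub : φ (b - algebraMap ℂ B z) = φ b - z := by simp [AlgHomClass.commutes]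
  rcases hw.apply_eq_zero_or_apply_mul_apply_eq_one φ with h0 | h1
  · exact sub_eq_zero.1 (hsub ▸ h0)
  · have hle := inv_le_norm_apply_of_apply_mul_apply_eq_one h1
    rw [hsub, ← dist_eq_norm] at hle
    exact absurd hball hle.not_gt

theorem finite_spectrum_sdiff {b : B} (hb : b ∈ acc B) {U : Set ℂ} (hU : U ∈ 𝓝 0) :
    (spectrum ℂ b \ U).Finite := by
  by_contra hinf
  have hK : IsCompact (spectrum ℂ b \ interior U) := (spectrum.isCompact b).diff isOpen_interior
  obtain ⟨z, hz, hacc⟩ := Set.Infinite.exists_accPt_of_subset_isCompact hinf hK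
    (Set.sdiff_subset_sdiff_right interior_subset)
  have hz0 : z ≠ 0 := by
    rintro rfl
    exact hz.2 (mem_interior_iff_mem_nhds.2 hU)
  exact not_accPt_spectrum_of_mem_acc hb hz0 (hacc.mono (principal_mono.2 Set.sdiff_subset))

theorem exists_isSpectralIdempotent {b : B} (hb : b ∈ acc B) {U : Set ℂ} (hU : U ∈ 𝓝 0) :
    ∃ q, IsSpectralIdempotent b U q := by
  choose! w hw using hb
  have hfin := finite_spectrum_sdiff (b := b) (fun z hz => ⟨w z, hw z hz⟩) hU
  have hne : ∀ z ∈ hfin.toFinset, z ≠ 0 := by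
    rintro z hz rfl
    exact (hfin.mem_toFinset.1 hz).2 (mem_of_mem_nhds hU)
  refine ⟨∏ z ∈ hfin.toFinset, (b - algebraMap ℂ B z) * w z, ?_, fun φ => ?_⟩
  · exact Finset.prod_mul_distrib.symm.trans (Finset.prod_congr rfl fun z hz =>
      isIdempotentElem_mul_of_mul_mul_eq (hw z (hne z hz)).2.1)
  · rw [map_prod]
    refine ⟨fun h1 => ?_, fun hφU => Finset.prod_eq_one fun z hz => ?_⟩
    · by_contra hφU
      have hmem : φ b ∈ hfin.toFinset :=
        hfin.mem_toFinset.2 ⟨AlgHom.apply_mem_spectrum φ b, hφU⟩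
      rw [Finset.prod_eq_zero hmem (by simp [AlgHomClass.commutes])] at h1
      exact zero_ne_one h1
    · have hφz : φ b ≠ z := by
        rintro rfl
        exact (hfin.mem_toFinset.1 hz).2 hφU
      have hφd : φ (b - algebraMap ℂ B z) ≠ 0 := by
        simpa [AlgHomClass.commutes, sub_eq_zero] using hφz
      rw [map_mul]
      exact ((hw z (hne z hz)).apply_eq_zero_or_apply_mul_apply_eq_one φ).resolve_left hφd

theorem IsAGDrazinInverse.exists_isSpectralIdempotent {a x : B} (h : IsAGDrazinInverse a x) :
    ∃ r : ℝ≥0, 0 < r ∧ r ≤ 1 ∧ ∃ p, IsSpectralIdempotent a (ball 0 r) p ∧ a * p ∈ acc B := by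
  obtain ⟨-, hxax, hacc⟩ := h
  let r : ℝ≥0 := (‖x‖₊ * ‖(1 : B)‖₊ + 1)⁻¹
  have hr : 0 < r := by positivity
  obtain ⟨q, hq, hqφ⟩ := AGDrazin.exists_isSpectralIdempotent hacc (ball_mem_nhds 0 hr)
  refine ⟨r, hr, inv_le_one_of_one_le₀ (by simp), (1 - a * x) * q, ⟨?_, fun φ => ?_⟩, ?_⟩
  · exact (isIdempotentElem_mul_of_mul_mul_eq hxax).one_sub.mul hq
  · rcases apply_mul_apply_eq_zero_or_one hxax φ with h0 | h1
    · have hφb : φ (a - a ^ 2 * x) = φ a := by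
        simp only [map_sub, map_mul, map_pow]
        linear_combination -φ a * h0
      rw [map_mul, map_sub, map_one, map_mul, h0, sub_zero, one_mul, hqφ, hφb]
      rfl
    · have hφp : φ ((1 - a * x) * q) = 0 := by simp [h1]
      have hle : (r : ℝ) ≤ ‖φ a‖ := inv_le_norm_apply_of_apply_mul_apply_eq_one h1
      simp [hφp, hle]
  · have hpb : a * ((1 - a * x) * q) = (a - a ^ 2 * x) * q := by ring
    rw [hpb]
    exact mul_mem_acc_of_isIdempotentElem hacc hq

namespace IsSpectralIdempotent

variable {a p : B} {r : ℝ≥0}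

theorem isUnit_add {U : Set ℂ} (hp : IsSpectralIdempotent a U p) (h0 : 0 ∈ U) (h1 : -1 ∉ U) :
    IsUnit (a + p) := by
  by_contra hu
  obtain ⟨φ, hφ⟩ := CharacterSpace.exists_apply_eq_zero hu
  rw [map_add] at hφ
  rcases hp.apply_eq_zero_or_one φ with hφp | hφp
  · rw [hφp, add_zero] at hφ
    exact zero_ne_one (hφp.symm.trans ((hp.2 φ).2 (hφ ▸ h0)))
  · rw [hφp] at hφ
    exact h1 (eq_neg_of_add_eq_zero_left hφ ▸ (hp.2 φ).1 hφp)

theorem spectralRadius_mul_lt (hp : IsSpectralIdempotent a (ball 0 r) p) (hr : 0 < r) :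
    spectralRadius ℂ (a * p) < r := by
  rcases subsingleton_or_nontrivial B with _ | _
  · simpa [spectrum.SpectralRadius.of_subsingleton] using hr
  refine spectrum.spectralRadius_lt_of_forall_lt _ fun z hz => ?_
  obtain ⟨φ, rfl⟩ := CharacterSpace.mem_spectrum_iff_exists.1 hz
  rcases hp.apply_eq_zero_or_one φ with hφp | hφp
  · simpa [hφp] using hr
  · have hlt : ‖φ a‖₊ < r := mem_ball_zero_iff.1 ((hp.2 φ).1 hφp)
    simpa [hφp] using hlt

theorem spectralRadius_le_inv (hp : IsSpectralIdempotent a (ball 0 r) p) (hr : 0 < r) {y : B}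
    (hya : y * a = 1 - p) (hyp : y * p = 0) : spectralRadius ℂ y ≤ (r : ℝ≥0∞)⁻¹ := by
  refine iSup₂_le fun z hz => ?_
  obtain ⟨φ, rfl⟩ := CharacterSpace.mem_spectrum_iff_exists.1 hz
  rw [← ENNReal.coe_inv hr.ne', ENNReal.coe_le_coe]
  rcases hp.apply_eq_zero_or_one φ with hφp | hφp
  · have hle : r ≤ ‖φ a‖₊ := by
      by_contra! hlt
      have hmem : φ a ∈ ball 0 (r : ℝ) := mem_ball_zero_iff.2 hlt
      exact zero_ne_one (hφp.symm.trans ((hp.2 φ).2 hmem))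
    have hφy : φ y * φ a = 1 := by rw [← map_mul, hya, map_sub, map_one, hφp, sub_zero]
    rw [eq_inv_of_mul_eq_one_left hφy, nnnorm_inv]
    gcongr
  · have hφy : φ y = 0 := by rw [← mul_one (φ y), ← hφp, ← map_mul, hyp, map_zero]
    simp [hφy]

theorem spectralRadius_mul_lt_one (hp : IsSpectralIdempotent a (ball 0 r) p) (hr : 0 < r) {y : B}
    (hya : y * a = 1 - p) (hyp : y * p = 0) :
    spectralRadius ℂ (a * p) * spectralRadius ℂ y < 1 := by
  have hr0 : (r : ℝ≥0∞) ≠ 0 := by exact_mod_cast hr.ne'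
  calc spectralRadius ℂ (a * p) * spectralRadius ℂ y
      ≤ spectralRadius ℂ (a * p) * (r : ℝ≥0∞)⁻¹ := by
        gcongr
        exact hp.spectralRadius_le_inv hr hya hyp
    _ < 1 := by
      rw [← div_eq_mul_inv, ENNReal.div_lt_iff (.inl hr0) (.inl ENNReal.coe_ne_top), one_mul]
      exact hp.spectralRadius_mul_lt hr

end IsSpectralIdempotent

end Commutative

theorem IsAGDrazinInverse.exists_isIdempotentElem {A : Type*} [NormedRing A] [NormedAlgebra ℂ A]
    [CompleteSpace A] {a x : A} (h : IsAGDrazinInverse a x) :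
    ∃ p, IsIdempotentElem p ∧ p ∈ Set.centralizer (Set.centralizer {a}) ∧ IsUnit (a + p) ∧
      a * p ∈ acc A := by
  have hax : a * x = x * a := h.1 a rfl
  have hS : ∀ s ∈ ({a, x} : Set A), ∀ t ∈ ({a, x} : Set A), s * t = t * s := by
    rintro s (rfl | rfl) t (rfl | rfl)
    exacts [rfl, hax, hax.symm, rfl]
  let _ := bicommutantNormedCommRing hS
  let b : bicommutant {a, x} := ⟨a, Set.subset_centralizer_centralizer (.inl rfl)⟩
  let w : bicommutant {a, x} := ⟨x, Set.subset_centralizer_centralizer (.inr rfl)⟩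
  have hbw : IsAGDrazinInverse b w := isAGDrazinInverse_coe_bicommutant_iff.1 h
  obtain ⟨r, hr, hr1, p, hp, hacc⟩ := hbw.exists_isSpectralIdempotent
  have hu : IsUnit (b + p) := hp.isUnit_add (mem_ball_self hr) (by simpa using hr1)
  have hbp : Commute b p := mul_comm b p
  have hya := inverse_add_mul_one_sub_mul hp.1 hbp hu
  have hyby := inverse_add_mul_one_sub_mul_mul hp.1 hbp hu
  have hb := sub_sq_mul_inverse_add_mul_one_sub hp.1 hbp hu
  set y := Ring.inverse (b + p) * (1 - p) with hy_def
  have hyp : y * p = 0 := by rw [hy_def, mul_assoc, hp.1.one_sub_mul_self, mul_zero]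
  have hρ := hp.spectralRadius_mul_lt_one hr hya hyp
  rw [← hb, ← spectralRadius_coe_bicommutant, ← spectralRadius_coe_bicommutant] at hρ
  have hy : (y : A) ∈ bicommutant {a} := mem_centralizer_centralizer_of_spectralRadius_mul_lt_one
    (congrArg Subtype.val (mul_comm b y)) (congrArg Subtype.val hyby) hρ
  have ha : a ∈ bicommutant {a} := Set.subset_centralizer_centralizer rfl
  have hp_eq : (p : A) = 1 - y * a :=
    congrArg Subtype.val (show p = 1 - y * b by rw [hya, sub_sub_cancel])
  exact ⟨p, congrArg Subtype.val hp.1, hp_eq ▸ sub_mem (one_mem _) (mul_mem hy ha),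
    hu.map (bicommutant _).val, coe_bicommutant_mem_acc_iff.2 hacc⟩

end AGDrazin

theorem mainTheorem3 {A : Type*} [NormedRing A] [NormedAlgebra ℂ A] [CompleteSpace A] (a : A) :
    List.TFAE
      [ a ∈ AGDrazin.agDrazin A,
        ∃ p : A, IsIdempotentElem p ∧ p ∈ Set.centralizer (Set.centralizer {a}) ∧
          IsUnit (a + p) ∧ a * p ∈ AGDrazin.acc A,
        ∃ p : A, IsIdempotentElem p ∧ p ∈ Set.centralizer {a} ∧
          IsUnit (a + p) ∧ a * p ∈ AGDrazin.acc A ] ∧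
    ∀ p : A, IsIdempotentElem p → p ∈ Set.centralizer {a} →
      IsUnit (a + p) → a * p ∈ AGDrazin.acc A →
        AGDrazin.IsAGDrazinInverse a (Ring.inverse (a + p) * (1 - p)) := by
  refine ⟨?_, fun p hp hpa hu hacc =>
    AGDrazin.isAGDrazinInverse_inverse_add_mul_one_sub hp (hpa a rfl) hu hacc⟩
  tfae_have 1 → 2 := fun ⟨_, hx⟩ => hx.exists_isIdempotentElem
  tfae_have 2 → 3 := fun ⟨p, hp, hpa, hu, hacc⟩ =>
    have ha : {a} ⊆ Set.centralizer {a} := by simp [Set.mem_centralizer_iff]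
    ⟨p, hp, Set.centralizer_subset ha hpa, hu, hacc⟩
  tfae_have 3 → 1 := fun ⟨_, hp, hpa, hu, hacc⟩ =>
    ⟨_, AGDrazin.isAGDrazinInverse_inverse_add_mul_one_sub hp (hpa a rfl) hu hacc⟩
  tfae_finish
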